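/- Let $R$ be an associative ring with unit and let $M$ be a left $R$-module. Let $\sigma[M]$ be the full subcategory of $R$-modules that are isomorphic to a submodule of a quotient of a direct sum of copies of $M$. Assume that $M$ is projective in $\sigma[M]$, that is, every morphism $M\to B$ lifts along every epimorphism $A\to B$ with $A,B\in\sigma[M]$. For submodules $K,L\le M$ put $K_ML=\sum\{f(K)\mid f\in\mathrm{Hom}_R(M,L)\}$, and assume that $M$ is semiprime, that is, every fully invariant submodule $K\le M$ with $K_MK=0$ is zero. Then the following two conditions are equivalent: 1. $M$ has finite uniform dimension (it contains no infinite direct sum of nonzero submodules) and has enough monoforms, that is, every nonzero submodule of $M$ contains a monoform submodule, where a module $U$ is monoform if $U\ne 0$ and every morphism $N\to U$ from a submodule $N\le U$ is zero or a monomorphism. 2. $M$ is a Goldie module, that is, $M$ has finite uniform dimension and satisfies the ascending chain condition on left annihilators, the submodules of the form $\bigcap_{f\in X}\ker f$ with $X\subseteq\mathrm{End}_R(M)$. -/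

import Mathlib

/-!
Modules over an associative ring `R` with unit are left modules.
-/

namespace GoldieModules

universe u v

section Category

variable (R : Type u) [Ring R] (M : Type v) [AddCommGroup M] [Module R M]

/-- `X` is `M`-generated: there is an epimorphism from a direct sum of copies of `M` onto `X`. -/
def IsGenerated (X : Type v) [AddCommGroup X] [Module R X] : Prop :=
  ∃ (ι : Type v) (p : (ι →₀ M) →ₗ[R] X), Function.Surjective p

/-- `X` is an object of `σ[M]`: it is isomorphic to a submodule of (that is, it embeds in)
an `M`-generated module. -/
def InSigma (X : Type v) [AddCommGroup X] [Module R X] : Prop :=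
  ∃ (Y : Type v) (_ : AddCommGroup Y) (_ : Module R Y) (i : X →ₗ[R] Y),
    IsGenerated R M Y ∧ Function.Injective i

/-- `M` is projective in the category `σ[M]`: every morphism from `M` to `B` lifts along every
epimorphism `A → B` of `σ[M]` (epimorphisms in `σ[M]` are the surjective maps).
Objects in the universe of `M` are enough, whatever the universe of `R`: a cyclic module in `σ[M]`
is a subquotient of a finite power of `M`, so lifting `M → B` along `A → B` only involves a
submodule of `A` that is generated by `M`-many elements and has a copy in that universe. -/
def IsProjectiveInSigma : Prop :=
  ∀ (A B : Type v) [AddCommGroup A] [Module R A] [AddCommGroup B] [Module R B],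
    InSigma R M A → InSigma R M B →
    ∀ (g : A →ₗ[R] B) (f : M →ₗ[R] B), Function.Surjective g →
      ∃ h : M →ₗ[R] A, g ∘ₗ h = f

end Category

section Submodules

variable {R : Type u} [Ring R] {M : Type v} [AddCommGroup M] [Module R M]

/-- The product `K_M L`, the sum of the images `f(K)` over all `f : M → L`,
as a submodule of `M`. -/
def prod (K L : Submodule R M) : Submodule R M :=
  ⨆ f : M →ₗ[R] L, K.map (L.subtype ∘ₗ f)

/-- `N` is a semiprime submodule in `M`. -/
def IsSemiprimeSubmodule (N : Submodule R M) : Prop :=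
  N.IsFullyInvariant ∧
    ∀ K : Submodule R M, K.IsFullyInvariant → prod K K ≤ N → K ≤ N

/-- A left annihilator in `M`: an intersection of the kernels of a set of endomorphisms. -/
def IsLeftAnnihilator (N : Submodule R M) : Prop :=
  ∃ X : Set (Module.End R M), N = ⨅ f ∈ X, LinearMap.ker f

end Submodules

section Modules

variable (R : Type u) [Ring R] (M : Type v) [AddCommGroup M] [Module R M]

/-- `M` is a semiprime module: `0` is a semiprime submodule in `M`. -/
def IsSemiprimeModule : Prop :=
  IsSemiprimeSubmodule (⊥ : Submodule R M)

/-- `M` is monoform: it is nonzero, and every morphism from a submodule of `M` to `M` is zero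
or a monomorphism. -/
def IsMonoform : Prop :=
  Nontrivial M ∧
    ∀ (N : Submodule R M) (f : N →ₗ[R] M), f = 0 ∨ Function.Injective f

/-- `M` has enough monoforms: each nonzero submodule of `M` contains a monoform submodule. -/
def HasEnoughMonoforms : Prop :=
  ∀ N : Submodule R M, N ≠ ⊥ → ∃ U : Submodule R M, U ≤ N ∧ IsMonoform R U

/-- `M` has finite uniform dimension: there is no infinite direct sum of nonzero submodules
inside `M`. -/
def HasFiniteUniformDimension : Prop :=
  ¬ ∃ N : ℕ → Submodule R M, iSupIndep N ∧ ∀ i, N i ≠ ⊥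

/-- The ascending chain condition on left annihilators in `M`. -/
def ACCLeftAnnihilators : Prop :=
  ∀ A : ℕ → Submodule R M, Monotone A → (∀ n, IsLeftAnnihilator (A n)) →
    ∃ n, ∀ m, n ≤ m → A m = A n

/-- `M` is a Goldie module. -/
def IsGoldieModule : Prop :=
  ACCLeftAnnihilators R M ∧ HasFiniteUniformDimension R M

end Modules

end GoldieModules

/-!
Let `M` be projective in `σ[M]` and semiprime. Two tools carry the proof.

* Lifting (`exists_lift`): if `X` embeds in `M` and `h : X → M`, then every endomorphism of `M` with
  image inside the image of `h` factors through `h`.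
* Semiprimeness without full invariance (`exists_end_ne_zero`): every nonzero submodule `N` admits
  `p : M → N` with `p(N) ≠ 0`. If every `M → N` killed `N`, then so would every map from `M` to the
  fully invariant closure `K` of `N`, because such a map lifts to a direct sum of copies of `N`;
  this gives `K_M K = 0`, hence `K = 0`.

Suppose that `M` is Goldie. Every nonzero submodule contains a uniform one, by finite uniform
dimension, so it is enough that a uniform submodule `U` is monoform. An endomorphism `p` with image
in `U` is zero or injective on `U` (`eq_zero_or_injective_on_uniform`): take a
counterexample `p` with maximal kernel, choose `g : M → p(U)` nonzero on `p(U)`, and lift it through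
`p` to see that `g` is not injective on `U`; then `g ∘ p` is a counterexample with larger kernel.
A partial endomorphism `N → U` is reduced to this case by composing it with a suitable `M → N`.

Conversely, suppose that `M` has finite uniform dimension and enough monoforms. In an ascending
chain of submodules the terms are eventually essential in all later ones
(`exists_eventually_essential`), so it is enough that a left annihilator `A` which is essential in a
larger submodule `B` equals `B`. Otherwise some endomorphism `f` kills `A` and not `B`. Take a
monoform `U ≤ f(B)` and `p : M → U` nonzero on `U`, and lift `p` to `q : M → B`. Since `ker f` is
essential in `B`, the kernel of `p = f ∘ q` meets `U`, against the injectivity of `p` on `U`.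
-/

namespace GoldieModules

universe u v

variable {R : Type u} [Ring R] {M : Type v} [AddCommGroup M] [Module R M]

/-! ### Independence and uniform submodules -/

/-- A family over a linear order is independent once each member is disjoint from the finite sums of
the members before it. -/
theorem iSupIndep_of_disjoint_sup_lt {ι : Type*} [LinearOrder ι] {N : ι → Submodule R M}
    (h : ∀ i (s : Finset ι), (∀ j ∈ s, j < i) → Disjoint (N i) (s.sup N)) : iSupIndep N := by
  rw [iSupIndep_iff_supIndep]
  intro s
  induction s using Finset.induction_on_max with
  | empty => exact Finset.supIndep_empty _
  | insert a s hs ih => exact ih.insert (h a s hs)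

/-- A submodule `U` is uniform: it is nonzero and any two nonzero submodules of `U` meet
nontrivially. -/
def IsUniform (U : Submodule R M) : Prop :=
  U ≠ ⊥ ∧ ∀ A B : Submodule R M, A ≤ U → B ≤ U → Disjoint A B → A = ⊥ ∨ B = ⊥

theorem exists_isUniform_le (hfin : HasFiniteUniformDimension R M) {N : Submodule R M}
    (hN : N ≠ ⊥) : ∃ U ≤ N, IsUniform U := by
  by_contra! hno
  have key : ∀ X : {X : Submodule R M // X ≤ N ∧ X ≠ ⊥},
      ∃ (A : Submodule R M) (B : {X : Submodule R M // X ≤ N ∧ X ≠ ⊥}),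
        A ≠ ⊥ ∧ A ≤ X.1 ∧ B.1 ≤ X.1 ∧ Disjoint A B.1 := by
    rintro ⟨X, hXN, hX⟩
    have := hno X hXN
    simp only [IsUniform, not_and, not_forall, not_or] at this
    obtain ⟨A, B, hA, hB, hAB, hA0, hB0⟩ := this hX
    exact ⟨A, ⟨B, hB.trans hXN, hB0⟩, hA0, hA, hB, hAB⟩
  choose A B hA0 hA hB hAB using key
  let X : ℕ → {X : Submodule R M // X ≤ N ∧ X ≠ ⊥} := fun n ↦ B^[n] ⟨N, le_rfl, hN⟩
  have hX : ∀ n, X (n + 1) = B (X n) := fun n ↦ Function.iterate_succ_apply' _ _ _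
  have hanti : Antitone fun n ↦ (X n).1 := antitone_nat_of_succ_le fun n ↦ by
    rw [hX]; exact hB _
  refine hfin ⟨fun n ↦ A (X n), ?_, fun n ↦ hA0 _⟩
  -- Each `A (X n)` is disjoint from the later terms, which all lie in `X (n + 1)`, so the order
  -- of the indices is reversed.
  have hind : iSupIndep fun n : ℕᵒᵈ ↦ A (X (OrderDual.ofDual n)) :=
    iSupIndep_of_disjoint_sup_lt fun i s hs ↦ by
      refine (hAB (X (OrderDual.ofDual i))).mono_right (Finset.sup_le fun j hj ↦ ?_)
      rw [← hX]
      exact (hA _).trans (hanti (Nat.succ_le_of_lt (OrderDual.ofDual_lt_ofDual.2 (hs j hj))))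
  exact hind.comp OrderDual.toDual.injective

/-- With finite uniform dimension, the terms of an ascending chain are eventually essential in all
later ones. -/
theorem exists_eventually_essential (hfin : HasFiniteUniformDimension R M)
    {A : ℕ → Submodule R M} (hA : Monotone A) :
    ∃ n, ∀ m, n ≤ m → ∀ C ≤ A m, Disjoint C (A n) → C = ⊥ := by
  by_contra! hno
  choose m hm C hC hd hC0 using hno
  let k : ℕ → ℕ := fun n ↦ m^[n] 0
  have hk : ∀ n, k (n + 1) = m (k n) := fun n ↦ Function.iterate_succ_apply' _ _ _
  have hmono : Monotone k := monotone_nat_of_le_succ fun n ↦ by rw [hk]; exact hm _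
  refine hfin ⟨fun n ↦ C (k n), iSupIndep_of_disjoint_sup_lt fun i s hs ↦ ?_, fun n ↦ hC0 _⟩
  refine (hd (k i)).mono_right (Finset.sup_le fun j hj ↦ (hC _).trans (hA ?_))
  rw [← hk]
  exact hmono (Nat.succ_le_of_lt (hs j hj))

/-! ### Projectivity and semiprimeness -/

theorem inSigma_finsupp_of_injective {ι : Type v} {X : Type v} [AddCommGroup X] [Module R X]
    (i : X →ₗ[R] M) (hi : Function.Injective i) : InSigma R M (ι →₀ X) :=
  ⟨ι →₀ M, inferInstance, inferInstance, Finsupp.mapRange.linearMap i,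
    ⟨ι, LinearMap.id, Function.surjective_id⟩,
    Finsupp.mapRange_injective i (map_zero i) hi⟩

theorem inSigma_of_injective {X : Type v} [AddCommGroup X] [Module R X]
    (i : X →ₗ[R] M) (hi : Function.Injective i) : InSigma R M X :=
  ⟨M, inferInstance, inferInstance, i,
    ⟨PUnit, Finsupp.lapply PUnit.unit, fun x ↦ ⟨Finsupp.single PUnit.unit x, by simp⟩⟩, hi⟩

/-- The form in which projectivity is used: the codomain of `h` is cut down to its image, which
lies in `σ[M]` as a submodule of `M`. -/
theorem exists_lift_of_inSigma (hproj : IsProjectiveInSigma R M) {X : Type v} [AddCommGroup X]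
    [Module R X] (hX : InSigma R M X) (h : X →ₗ[R] M) (p : M →ₗ[R] M)
    (hp : p.range ≤ h.range) : ∃ q : M →ₗ[R] X, h ∘ₗ q = p := by
  obtain ⟨q, hq⟩ := hproj X h.range hX
    (inSigma_of_injective h.range.subtype h.range.subtype_injective) h.rangeRestrict
    (p.codRestrict h.range fun x ↦ hp ⟨x, rfl⟩) h.surjective_rangeRestrict
  exact ⟨q, LinearMap.ext fun x ↦ congrArg Subtype.val (LinearMap.congr_fun hq x)⟩

theorem exists_lift (hproj : IsProjectiveInSigma R M) {X : Type v} [AddCommGroup X]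
    [Module R X] (i : X →ₗ[R] M) (hi : Function.Injective i) (h : X →ₗ[R] M) (p : M →ₗ[R] M)
    (hp : p.range ≤ h.range) : ∃ q : M →ₗ[R] X, h ∘ₗ q = p :=
  exists_lift_of_inSigma hproj (inSigma_of_injective i hi) h p hp

/-- In a semiprime module projective in `σ[M]`, every nonzero submodule `N` satisfies `N_M N ≠ 0`,
whether or not `N` is fully invariant. -/
theorem exists_end_ne_zero (hproj : IsProjectiveInSigma R M) (hsemi : IsSemiprimeModule R M)
    {N : Submodule R M} (hN : N ≠ ⊥) :
    ∃ p : M →ₗ[R] M, p.range ≤ N ∧ ∃ x ∈ N, p x ≠ 0 := by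
  by_contra! hno
  -- The fully invariant closure of `N` is the image of `h : N^(End M) → M`.
  let h : ((M →ₗ[R] M) →₀ N) →ₗ[R] M := Finsupp.lsum ℕ fun g ↦ g ∘ₗ N.subtype
  have hsingle : ∀ (g : M →ₗ[R] M) (x : N), h (Finsupp.single g x) = g x := fun g x ↦ by
    simp [h]
  have hinv : h.range.IsFullyInvariant := by
    rintro f _ ⟨c, rfl⟩
    induction c using Finsupp.induction_linear with
    | zero => simp
    | add a b ha hb => rw [map_add]; exact add_mem ha hb
    | single g x =>
      exact ⟨Finsupp.single (f ∘ₗ g) x, by rw [hsingle, hsingle]; rfl⟩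
  have hprod : prod h.range h.range ≤ ⊥ := by
    refine iSup_le fun f ↦ ?_
    rintro _ ⟨_, ⟨c, rfl⟩, rfl⟩
    induction c using Finsupp.induction_linear with
    | zero => simp
    | add a b ha hb => rw [map_add, map_add]; exact add_mem ha hb
    | single g x =>
      obtain ⟨q, hq⟩ := exists_lift_of_inSigma hproj
        (inSigma_finsupp_of_injective N.subtype N.subtype_injective) h
        ((h.range.subtype ∘ₗ f) ∘ₗ g) (by rintro _ ⟨y, rfl⟩; exact (f (g y)).2)
      -- Every component of `q` is a map `M → N`, so it kills `N`.
      have hqx : q x = 0 := by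
        ext g'
        exact hno (N.subtype ∘ₗ Finsupp.lapply g' ∘ₗ q)
          (by rintro _ ⟨y, rfl⟩; exact (q y g').2) x x.2
      have := LinearMap.congr_fun hq (x : M)
      rw [LinearMap.comp_apply, hqx, map_zero] at this
      rw [hsingle]
      exact this.symm
  refine hN (le_bot_iff.1 (le_trans ?_ (hsemi.2 _ hinv hprod)))
  exact fun x hx ↦ ⟨Finsupp.single LinearMap.id ⟨x, hx⟩, by rw [hsingle]; rfl⟩

/-! ### Goldie modules have enough monoforms -/

theorem isLeftAnnihilator_ker (f : Module.End R M) : IsLeftAnnihilator (LinearMap.ker f) :=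
  ⟨{f}, by simp⟩

theorem wellFoundedGT_of_accLeftAnnihilators (hacc : ACCLeftAnnihilators R M) :
    WellFoundedGT {N : Submodule R M // IsLeftAnnihilator N} := by
  rw [wellFoundedGT_iff_monotone_chain_condition]
  intro a
  obtain ⟨n, hn⟩ := hacc (fun n ↦ (a n).1) (fun i j hij ↦ a.monotone hij) fun n ↦ (a n).2
  exact ⟨n, fun m hm ↦ Subtype.ext (hn m hm).symm⟩

/-- Two submodules of a uniform submodule, each containing a nonzero element, share a nonzero
element. -/
theorem IsUniform.exists_mem_ne_zero {U : Submodule R M} (hU : IsUniform U)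
    {A B : Submodule R M} (hA : A ≤ U) (hB : B ≤ U) {a b : M} (ha : a ∈ A) (ha0 : a ≠ 0)
    (hb : b ∈ B) (hb0 : b ≠ 0) : ∃ x ∈ A, x ∈ B ∧ x ≠ 0 := by
  by_contra! hno
  rcases hU.2 A B hA hB (Submodule.disjoint_def.2 hno) with rfl | rfl
  · exact ha0 ((Submodule.mem_bot R).1 ha)
  · exact hb0 ((Submodule.mem_bot R).1 hb)

theorem eq_zero_or_injective_on_uniform (hproj : IsProjectiveInSigma R M)
    (hsemi : IsSemiprimeModule R M) (hacc : ACCLeftAnnihilators R M) {U : Submodule R M}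
    (hU : IsUniform U) (p : M →ₗ[R] M) (hp : p.range ≤ U) :
    (∀ y ∈ U, p y = 0) ∨ ∀ y ∈ U, p y = 0 → y = 0 := by
  by_contra! hcon
  let S : Set {N : Submodule R M // IsLeftAnnihilator N} :=
    {K | ∃ f : M →ₗ[R] M, K.1 = f.ker ∧ f.range ≤ U ∧ (∃ y ∈ U, f y ≠ 0) ∧
      ∃ y ∈ U, f y = 0 ∧ y ≠ 0}
  have hS : S.Nonempty := ⟨⟨p.ker, isLeftAnnihilator_ker p⟩, p, rfl, hp, hcon⟩
  clear hcon hp p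
  have := wellFoundedGT_of_accLeftAnnihilators hacc
  obtain ⟨⟨_, _⟩, ⟨p, rfl, hp, ⟨y, hy, hpy⟩, z, hz, hpz, hz0⟩, hmax⟩ :=
    (wellFounded_gt (α := {N : Submodule R M // IsLeftAnnihilator N})).has_min S hS
  have hpU : U.map p ≤ U := Submodule.map_le_iff_le_comap.2 fun x _ ↦ hp ⟨x, rfl⟩
  have hpyU : p y ∈ U.map p := Submodule.mem_map_of_mem hy
  obtain ⟨g, hg, _, ⟨t, ht, rfl⟩, hgt⟩ := exists_end_ne_zero hproj hsemi (N := U.map p)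
    fun h0 ↦ hpy ((Submodule.mem_bot R).1 (h0 ▸ hpyU))
  obtain ⟨q, hq⟩ := exists_lift hproj U.subtype U.subtype_injective (p ∘ₗ U.subtype) g
    (hg.trans (by rw [LinearMap.range_comp, Submodule.range_subtype]))
  have hgq : ∀ x, g x = p (q x) := fun x ↦ (LinearMap.congr_fun hq x).symm
  -- `q(U)` meets `ker p`, so `g = p ∘ q` is not injective on `U`.
  obtain ⟨_, ⟨w, hw, rfl⟩, ⟨-, hk⟩, hw0⟩ := hU.exists_mem_ne_zero
    (A := U.map (U.subtype ∘ₗ q)) (B := U ⊓ p.ker)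
    (Submodule.map_le_iff_le_comap.2 fun x _ ↦ (q x).2) inf_le_left
    (Submodule.mem_map_of_mem (hpU (Submodule.mem_map_of_mem ht)))
    (fun h0 ↦ hgt (by
      rw [hgq]
      exact (congrArg p h0).trans (map_zero p)))
    ⟨hz, hpz⟩ hz0
  have hgw : g w = 0 := (hgq w).trans hk
  have hw0' : w ≠ 0 := by rintro rfl; exact hw0 (map_zero _)
  -- Hence `ker g` meets `p(U)`, and `ker (g ∘ p)` is strictly larger than `ker p`.
  obtain ⟨_, ⟨x, hx, rfl⟩, ⟨-, hgx⟩, hx0⟩ := hU.exists_mem_ne_zero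
    (A := U.map p) (B := U ⊓ g.ker) hpU inf_le_left hpyU hpy ⟨hw, hgw⟩ hw0'
  refine hmax ⟨(g ∘ₗ p).ker, isLeftAnnihilator_ker (g ∘ₗ p)⟩ ⟨g ∘ₗ p, rfl, ?_, ⟨t, ht, hgt⟩,
    z, hz, by simp [hpz], hz0⟩ ?_
  · exact (LinearMap.range_comp_le_range p g).trans (hg.trans hpU)
  · exact lt_of_le_of_ne (LinearMap.ker_le_ker_comp p g) fun heq ↦
      hx0 ((Subtype.ext_iff.1 heq).ge hgx)

theorem IsUniform.isMonoform (hproj : IsProjectiveInSigma R M)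
    (hsemi : IsSemiprimeModule R M) (hacc : ACCLeftAnnihilators R M) {U : Submodule R M}
    (hU : IsUniform U) : IsMonoform R U := by
  refine ⟨Submodule.nontrivial_iff_ne_bot.2 hU.1, fun N f ↦ ?_⟩
  by_contra! hcon
  obtain ⟨hf0, hfi⟩ := hcon
  let i : N →ₗ[R] M := U.subtype ∘ₗ N.subtype
  have hi : Function.Injective i := U.subtype_injective.comp N.subtype_injective
  let h : N →ₗ[R] M := U.subtype ∘ₗ f
  have hker : ∀ x, h x = 0 → f x = 0 := fun x hx ↦ Subtype.ext hx
  have hhU : h.range ≤ U := by rintro _ ⟨x, rfl⟩; exact (f x).2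
  have hh0 : h.range ≠ ⊥ := fun h0 ↦ hf0 <| LinearMap.ext fun x ↦
    hker x (LinearMap.congr_fun (LinearMap.range_eq_bot.1 h0) x)
  obtain ⟨p, hp, x, hx, hpx⟩ := exists_end_ne_zero hproj hsemi hh0
  obtain ⟨q, hq⟩ := exists_lift hproj i hi h p hp
  have hpq : ∀ x, p x = h (q x) := fun x ↦ (LinearMap.congr_fun hq x).symm
  obtain ⟨k, hk, hk0⟩ : ∃ k, f k = 0 ∧ k ≠ 0 := by
    rw [injective_iff_map_eq_zero] at hfi
    push Not at hfi
    exact hfi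
  rcases eq_zero_or_injective_on_uniform hproj hsemi hacc hU p (hp.trans hhU) with hz | hinj
  · exact hpx (hz x (hhU hx))
  -- `q(U)` meets `ker f`, so `p = f ∘ q` has a nonzero kernel on `U`.
  obtain ⟨_, ⟨u, hu, rfl⟩, ⟨k', hk', hk'u⟩, hne⟩ := hU.exists_mem_ne_zero
    (A := U.map (i ∘ₗ q)) (B := f.ker.map i)
    (Submodule.map_le_iff_le_comap.2 fun x _ ↦ (q x).1.2)
    (Submodule.map_le_iff_le_comap.2 fun x _ ↦ x.1.2)
    (Submodule.mem_map_of_mem (hhU hx))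
    (fun h0 ↦ hpx (by
      rw [hpq, hi (h0.trans (map_zero i).symm), map_zero]))
    (Submodule.mem_map_of_mem hk) (fun h0 ↦ hk0 (hi (h0.trans (map_zero i).symm)))
  have hqu : q u = k' := (hi hk'u).symm
  have hu0 : u = 0 := hinj u hu (by
    rw [hpq, hqu]
    exact congrArg Subtype.val hk')
  exact hne (by rw [hu0, map_zero])

/-! ### Enough monoforms give the chain condition on left annihilators -/

/-- A left annihilator has no proper essential extension inside `M`. -/
theorem IsLeftAnnihilator.le_of_essential (hproj : IsProjectiveInSigma R M)
    (hsemi : IsSemiprimeModule R M) (hmon : HasEnoughMonoforms R M) {A B : Submodule R M}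
    (hA : IsLeftAnnihilator A) (hess : ∀ C ≤ B, Disjoint C A → C = ⊥) : B ≤ A := by
  obtain ⟨X, rfl⟩ := hA
  refine le_iInf₂ fun f hf ↦ ?_
  by_contra hBf
  obtain ⟨U, hUB, hUne, hU⟩ := hmon (B.map f) fun h0 ↦ hBf fun x hx ↦
    (Submodule.mem_bot R).1 (h0 ▸ Submodule.mem_map_of_mem hx)
  obtain ⟨p, hp, x, hx, hpx⟩ :=
    exists_end_ne_zero hproj hsemi (Submodule.nontrivial_iff_ne_bot.1 hUne)
  obtain ⟨q, hq⟩ := exists_lift hproj B.subtype B.subtype_injective (f ∘ₗ B.subtype) p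
    ((hp.trans hUB).trans (by rw [LinearMap.range_comp, Submodule.range_subtype]))
  have hpq : ∀ x, p x = f (q x) := fun x ↦ (LinearMap.congr_fun hq x).symm
  have hinj : ∀ u ∈ U, p u = 0 → u = 0 := by
    rcases hU ⊤ ((p.codRestrict U fun x ↦ hp ⟨x, rfl⟩) ∘ₗ U.subtype ∘ₗ (⊤ : Submodule R U).subtype)
      with h0 | hi
    · exact absurd (congrArg Subtype.val (LinearMap.congr_fun h0 ⟨⟨x, hx⟩, trivial⟩)) hpx
    · intro u hu hpu
      have := @hi ⟨⟨u, hu⟩, trivial⟩ 0 (Subtype.ext (by simpa using hpu))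
      exact congrArg (fun y ↦ ((y : U) : M)) (congrArg Subtype.val this)
  -- `f ∘ q = p` is injective on `U`, so `q(U)` misses `ker f`, and essentiality makes it zero.
  have hdis : U.map (B.subtype ∘ₗ q) = ⊥ := by
    refine hess _ (Submodule.map_le_iff_le_comap.2 fun x _ ↦ (q x).2) ?_
    rw [Submodule.disjoint_def]
    rintro _ ⟨u, hu, rfl⟩ huA
    have hfu : f (q u) = 0 := (iInf₂_le f hf : _ ≤ LinearMap.ker f) huA
    rw [hinj u hu ((hpq u).trans hfu), map_zero]
  have hqx : (q x : M) = 0 :=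
    (Submodule.mem_bot R).1 (hdis ▸ Submodule.mem_map_of_mem (f := B.subtype ∘ₗ q) hx)
  exact hpx (by rw [hpq, hqx, map_zero])

end GoldieModules

theorem corollary2p10 {R : Type*} [Ring R] {M : Type*} [AddCommGroup M] [Module R M]
    (hproj : GoldieModules.IsProjectiveInSigma R M)
    (hsemi : GoldieModules.IsSemiprimeModule R M) :
    (GoldieModules.HasFiniteUniformDimension R M ∧ GoldieModules.HasEnoughMonoforms R M) ↔
      GoldieModules.IsGoldieModule R M := by
  constructor
  · rintro ⟨hfin, hmon⟩
    refine ⟨fun A hA hann ↦ ?_, hfin⟩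
    obtain ⟨n, hn⟩ := GoldieModules.exists_eventually_essential hfin hA
    exact ⟨n, fun m hm ↦ le_antisymm
      ((hann n).le_of_essential hproj hsemi hmon (hn m hm)) (hA hm)⟩
  · rintro ⟨hacc, hfin⟩
    refine ⟨hfin, fun N hN ↦ ?_⟩
    obtain ⟨U, hUN, hU⟩ := GoldieModules.exists_isUniform_le hfin hN
    exact ⟨U, hUN, hU.isMonoform hproj hsemi hacc⟩
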